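/- For positive integers $r,s$ define integers $c_{r,s}(n)$, $n\ge 0$, by the formal power series identity $$\sum_{n=0}^\infty c_{r,s}(n)q^n=\frac{1}{\Psi(-q^r,q^s)},\qquad \Psi(a,b)=\sum_{n=0}^\infty a^{n(n+1)/2}b^{n(n-1)/2}-\sum_{n=-\infty}^{-1}a^{n(n+1)/2}b^{n(n-1)/2}.$$ Let $p$ be a prime with $p\equiv 11$ or $19\pmod{20}$. Then for all integers $n,k\ge 0$ with $p\nmid n$, $$c_{9,1}\left(8p^{2k+1}n+\frac{6p^{2k+2}+4}{5}\right)\equiv 0\pmod 2$$ and $$c_{9,1}\left(8p^{2k+1}n+\frac{26p^{2k+2}+4}{5}\right)\equiv 0\pmod 2.$$ -/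

import Mathlib

open PowerSeries

/-- The false theta function
`Ψ(a, b) = ∑_{n ≥ 0} a^{n(n+1)/2} b^{n(n-1)/2} - ∑_{n ≤ -1} a^{n(n+1)/2} b^{n(n-1)/2}`
at formal power series `a`, `b` with integer coefficients, the sums being taken coefficientwise.
In the second sum `n = -(m + 1)` with `m ≥ 0`, so that `n(n+1)/2 = m(m+1)/2` and
`n(n-1)/2 = (m+1)(m+2)/2`. (Each coefficient is a finite sum as soon as `a` and `b` have
vanishing constant coefficient; this is the only case used.) -/
noncomputable def falseTheta (a b : ℤ⟦X⟧) : ℤ⟦X⟧ :=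
  PowerSeries.mk fun N =>
    (∑ᶠ n : ℕ, coeff N (a ^ (n * (n + 1) / 2) * b ^ (n * (n - 1) / 2)))
      - ∑ᶠ m : ℕ, coeff N (a ^ (m * (m + 1) / 2) * b ^ ((m + 1) * (m + 2) / 2))

/-- The coefficients `c_{r,s}(n)` defined by `∑_{n ≥ 0} c_{r,s}(n) q^n = 1 / Ψ(-q^r, q^s)`
(for `r, s ≥ 1`, where the constant coefficient of `Ψ(-q^r, q^s)` is `1`). -/
noncomputable def recipFalseThetaCoeff (r s n : ℕ) : ℤ :=
  coeff n (invOfUnit (falseTheta (-(X : ℤ⟦X⟧) ^ r) ((X : ℤ⟦X⟧) ^ s)) 1)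

theorem coeff_falseTheta_term (r s i j N : ℕ) :
    coeff N ((-(X : ℤ⟦X⟧) ^ r) ^ i * ((X : ℤ⟦X⟧) ^ s) ^ j)
      = if N = r * i + s * j then (-1) ^ i else 0 := by
  have h : (-(X : ℤ⟦X⟧) ^ r) ^ i * ((X : ℤ⟦X⟧) ^ s) ^ j
      = C ((-1 : ℤ) ^ i) * X ^ (r * i + s * j) := by
    rw [neg_pow, ← pow_mul, ← pow_mul, pow_add, map_pow, map_neg, map_one]; ring
  rw [h, coeff_C_mul, coeff_X_pow]
  split_ifs <;> simp

/-- The two sums defining each coefficient of `Ψ(-q^r, q^s)` are genuinely finite. -/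
theorem falseTheta_finite (r s : ℕ) (hr : 1 ≤ r) (hs : 1 ≤ s) (N : ℕ) :
    (Function.support fun n : ℕ => coeff N ((-(X : ℤ⟦X⟧) ^ r) ^ (n * (n + 1) / 2)
        * ((X : ℤ⟦X⟧) ^ s) ^ (n * (n - 1) / 2))).Finite ∧
    (Function.support fun m : ℕ => coeff N ((-(X : ℤ⟦X⟧) ^ r) ^ (m * (m + 1) / 2)
        * ((X : ℤ⟦X⟧) ^ s) ^ ((m + 1) * (m + 2) / 2))).Finite := by
  constructor
  · refine (Set.finite_Iic N).subset fun n hn => ?_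
    rw [Function.mem_support, coeff_falseTheta_term] at hn
    have h := (ne_eq _ _ ▸ hn : ¬ _)
    rw [ite_eq_right_iff, Classical.not_imp] at h
    have h := h.1
    have h1 : n ≤ n * (n + 1) / 2 := by
      rw [Nat.le_div_iff_mul_le (by norm_num)]
      rcases Nat.eq_zero_or_pos n with rfl | h0
      · simp
      · exact Nat.mul_le_mul_left n (by omega)
    have h2 := Nat.mul_le_mul hr h1
    simp only [Set.mem_Iic]
    omega
  · refine (Set.finite_Iic N).subset fun n hn => ?_
    rw [Function.mem_support, coeff_falseTheta_term] at hn
    have h := (ne_eq _ _ ▸ hn : ¬ _)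
    rw [ite_eq_right_iff, Classical.not_imp] at h
    have h := h.1
    have h1 : n ≤ (n + 1) * (n + 2) / 2 := by
      rw [Nat.le_div_iff_mul_le (by norm_num)]
      nlinarith
    have h2 := Nat.mul_le_mul hs h1
    simp only [Set.mem_Iic]
    omega

theorem constantCoeff_falseTheta (r s : ℕ) (hr : 1 ≤ r) (hs : 1 ≤ s) :
    constantCoeff (falseTheta (-(X : ℤ⟦X⟧) ^ r) ((X : ℤ⟦X⟧) ^ s)) = 1 := by
  rw [← coeff_zero_eq_constantCoeff_apply, falseTheta, coeff_mk]
  simp only [coeff_falseTheta_term]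
  rw [finsum_eq_single _ 0, finsum_eq_zero_of_forall_eq_zero]
  · simp
  · intro m
    have h1 : 1 ≤ (m + 1) * (m + 2) / 2 := by
      rw [Nat.le_div_iff_mul_le (by norm_num)]
      nlinarith
    have h2 := Nat.mul_le_mul hs h1
    exact if_neg (by omega)
  · intro n hn
    have h1 : 1 ≤ n * (n + 1) / 2 := by
      rw [Nat.le_div_iff_mul_le (by norm_num)]
      have : 1 ≤ n := Nat.pos_of_ne_zero hn
      nlinarith
    have h2 := Nat.mul_le_mul hr h1
    exact if_neg (by omega)

/-- The generating function of `c_{r,s}` really is the reciprocal of `Ψ(-q^r, q^s)`. -/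
theorem falseTheta_mul_mk_recip (r s : ℕ) (hr : 1 ≤ r) (hs : 1 ≤ s) :
    falseTheta (-(X : ℤ⟦X⟧) ^ r) ((X : ℤ⟦X⟧) ^ s)
      * PowerSeries.mk (recipFalseThetaCoeff r s) = 1 := by
  have h : PowerSeries.mk (recipFalseThetaCoeff r s)
      = invOfUnit (falseTheta (-(X : ℤ⟦X⟧) ^ r) ((X : ℤ⟦X⟧) ^ s)) 1 := by
    ext n
    rw [coeff_mk, recipFalseThetaCoeff]
  rw [h]
  exact mul_invOfUnit _ _ (by rw [constantCoeff_falseTheta r s hr hs, Units.val_one])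

/-! Modulo 2 the signs of `Ψ(-q^9, q)` disappear and it becomes the theta function F = f(q, q^9).
Write A = f(q^2, q^3), B = f(q, q^4), K = f(q^3, q^7), P = ψ(q), T = ψ(q^5), G = 1/F, all over `ZMod
2`, where f(q)^2 = f(q^2). Splitting indices by parity gives F = K^4 + qB^8 and K = A^8 + q^3 F^4;
changes of variables in lattice sums give F A^2 = BT, B^2 K = AT, AB + qT^2 = P^2 and A^5 + qB^5 =
P. Eliminating F and K yields PT = (AB)^3 (`psi_mul_psiFive`), and with it the 2-dissections of G
give c(8m+2) ≡ [q^m] AP and c(8m+6) ≡ [q^m] AT. Completing squares, a nonzero coefficient forces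
40m+6 = x^2 + 5y^2, respectively 40m+26 = x^2 + 25y^2. Since p ≡ 3 (mod 4) and 5 is a square modulo
p, neither -5 nor -25 is one, so p divides each nonzero value of these forms to an even power. On
the given progressions that power is exactly 2k+1. -/

/-! ### Series counting representations by an exponent family -/

/-- The power series `∑ i, q ^ e i`, for a family of exponents each attained finitely often. -/
noncomputable def countSeries {ι : Type*} (e : ι → ℤ) : ℤ⟦X⟧ :=
  PowerSeries.mk fun N => (Nat.card {i // e i = N} : ℤ)

/-- A family of nonnegative exponents, each attained finitely often. -/
structure ProperExponent {ι : Type*} (e : ι → ℤ) : Prop where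
  nonneg : ∀ i, 0 ≤ e i
  finite : ∀ N : ℕ, Finite {i // e i = N}

theorem coeff_countSeries {ι : Type*} (e : ι → ℤ) (N : ℕ) :
    coeff N (countSeries e) = (Nat.card {i // e i = N} : ℤ) := by
  rw [countSeries, coeff_mk]

theorem countSeries_equiv {ι κ : Type*} (σ : ι ≃ κ) {e : ι → ℤ} {f : κ → ℤ}
    (h : ∀ i, f (σ i) = e i) : countSeries e = countSeries f := by
  ext N
  rw [coeff_countSeries, coeff_countSeries]
  congr 1
  exact Nat.card_congr (σ.subtypeEquiv fun i => by rw [h])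

theorem ProperExponent.equiv {ι κ : Type*} (σ : ι ≃ κ) {e : ι → ℤ} {f : κ → ℤ}
    (h : ∀ i, f (σ i) = e i) (hf : ProperExponent f) : ProperExponent e where
  nonneg i := h i ▸ hf.nonneg _
  finite N := by
    have := hf.finite N
    exact Finite.of_equiv _ (σ.subtypeEquiv fun i => by rw [h] : {i // e i = N} ≃ {i // f i = N}).symm

theorem ProperExponent.comp_injective {ι κ : Type*} {g : κ → ι} (hg : Function.Injective g)
    {e : ι → ℤ} (he : ProperExponent e) : ProperExponent (fun i => e (g i)) where
  nonneg i := he.nonneg _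
  finite N := by
    have := he.finite N
    exact Finite.of_injective (fun x : {i // e (g i) = N} => (⟨g x.1, x.2⟩ : {i // e i = N}))
      fun x y h => Subtype.ext (hg (congrArg Subtype.val h))

/-- Pairs with `e i + f j = N`, sorted by the value of `e i`. -/
noncomputable def fiberAddEquiv {ι κ : Type*} {e : ι → ℤ} {f : κ → ℤ}
    (he : ∀ i, 0 ≤ e i) (hf : ∀ i, 0 ≤ f i) (N : ℕ) :
    {x : ι × κ // e x.1 + f x.2 = N} ≃
      Σ p : Finset.HasAntidiagonal.antidiagonal N, {i // e i = (p.1.1 : ℕ)} × {j // f j = (p.1.2 : ℕ)} where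
  toFun x := ⟨⟨((e x.1.1).toNat, (f x.1.2).toNat), by
      have := x.2; have := he x.1.1; have := hf x.1.2
      rw [Finset.HasAntidiagonal.mem_antidiagonal]; omega⟩,
    ⟨x.1.1, by simp [he]⟩, ⟨x.1.2, by simp [hf]⟩⟩
  invFun y := ⟨(y.2.1.1, y.2.2.1), by
    have h := Finset.HasAntidiagonal.mem_antidiagonal.1 y.1.2
    have h1 := y.2.1.2
    have h2 := y.2.2.2
    simp only
    omega⟩
  left_inv x := rfl
  right_inv := by
    rintro ⟨⟨⟨a, b⟩, hp⟩, ⟨i, hi⟩, ⟨j, hj⟩⟩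
    simp only at hi hj
    have ha : a = (e i).toNat := by omega
    have hb : b = (f j).toNat := by omega
    subst ha hb
    rfl

theorem countSeries_mul {ι κ : Type*} {e : ι → ℤ} {f : κ → ℤ}
    (he : ProperExponent e) (hf : ProperExponent f) :
    countSeries e * countSeries f = countSeries fun x : ι × κ => e x.1 + f x.2 := by
  ext N
  have h1 := he.finite
  have h2 := hf.finite
  rw [coeff_mul, coeff_countSeries, Nat.card_congr (fiberAddEquiv he.nonneg hf.nonneg N),
    Nat.card_sigma, ← Finset.sum_coe_sort]
  simp only [coeff_countSeries, Nat.card_prod]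
  push_cast
  rfl

theorem ProperExponent.add {ι κ : Type*} {e : ι → ℤ} {f : κ → ℤ}
    (he : ProperExponent e) (hf : ProperExponent f) :
    ProperExponent fun x : ι × κ => e x.1 + f x.2 where
  nonneg x := add_nonneg (he.nonneg _) (hf.nonneg _)
  finite N := by
    have h1 := he.finite
    have h2 := hf.finite
    exact Finite.of_equiv _ (fiberAddEquiv he.nonneg hf.nonneg N).symm

theorem countSeries_sumElim {ι κ : Type*} {e : ι ⊕ κ → ℤ} (he : ProperExponent e) :
    countSeries e = countSeries (fun i => e (Sum.inl i)) + countSeries (fun i => e (Sum.inr i)) := by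
  ext N
  have h1 := (he.comp_injective Sum.inl_injective).finite N
  have h2 := (he.comp_injective Sum.inr_injective).finite N
  rw [map_add, coeff_countSeries, coeff_countSeries, coeff_countSeries,
    Nat.card_congr (Equiv.subtypeSum (p := fun x => e x = N)), Nat.card_sum]
  push_cast
  rfl

theorem countSeries_fin_prod {ι : Type*} {n : ℕ} {e : Fin n × ι → ℤ} (he : ProperExponent e) :
    countSeries e = ∑ r, countSeries (fun i => e (r, i)) := by
  ext N
  have h (r : Fin n) := (he.comp_injective (Prod.mk_right_injective r)).finite N
  have σ : {x // e x = N} ≃ Σ r, {i // e (r, i) = N} :=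
    { toFun := fun x => ⟨x.1.1, x.1.2, x.2⟩
      invFun := fun y => ⟨(y.1, y.2.1), y.2.2⟩
      left_inv := fun x => rfl
      right_inv := fun x => rfl }
  rw [map_sum, coeff_countSeries, Nat.card_congr σ, Nat.card_sigma]
  simp only [coeff_countSeries]
  push_cast
  rfl

theorem X_pow_mul_countSeries {ι : Type*} {e : ι → ℤ} (he : ∀ i, 0 ≤ e i) (k : ℕ) :
    X ^ k * countSeries e = countSeries fun i => e i + k := by
  ext N
  rw [coeff_X_pow_mul', coeff_countSeries]
  split_ifs with h
  · rw [coeff_countSeries]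
    congr 1
    refine Nat.card_congr (Equiv.subtypeEquivRight fun i => ?_)
    rw [Nat.cast_sub h]
    omega
  · have : IsEmpty {i // e i + (k : ℤ) = N} := ⟨fun x => by
      have := x.2
      have := he x.1
      omega⟩
    rw [coeff_countSeries, Nat.card_of_isEmpty, Nat.cast_zero]

/-! ### Reduction modulo 2 and the Frobenius -/

/-- The reduction of `countSeries` modulo `2`. -/
noncomputable def paritySeries {ι : Type*} (e : ι → ℤ) : (ZMod 2)⟦X⟧ :=
  PowerSeries.map (Int.castRingHom (ZMod 2)) (countSeries e)

theorem coeff_paritySeries {ι : Type*} (e : ι → ℤ) (N : ℕ) :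
    coeff N (paritySeries e) = (Nat.card {i // e i = N} : ZMod 2) := by
  simp [paritySeries, coeff_countSeries]

theorem expand_two_eq_sq (f : (ZMod 2)⟦X⟧) : expand 2 two_ne_zero f = f ^ 2 := by
  have h := MvPowerSeries.map_frobenius_expand 2 two_ne_zero (f := f)
  rw [ZMod.frobenius_zmod, MvPowerSeries.map_id] at h
  exact h

theorem coeff_even_sq (f : (ZMod 2)⟦X⟧) (m : ℕ) : coeff (2 * m) (f ^ 2) = coeff m f := by
  rw [← expand_two_eq_sq, coeff_expand_mul]

theorem coeff_odd_sq (f : (ZMod 2)⟦X⟧) (m : ℕ) : coeff (2 * m + 1) (f ^ 2) = 0 := by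
  rw [← expand_two_eq_sq, coeff_expand_of_not_dvd _ _ _ (by omega)]

theorem paritySeries_sq {ι : Type*} (e : ι → ℤ) :
    paritySeries e ^ 2 = paritySeries fun i => 2 * e i := by
  ext N
  obtain ⟨m, rfl | rfl⟩ := Nat.even_or_odd' N
  · rw [coeff_even_sq, coeff_paritySeries, coeff_paritySeries]
    congr 1
    exact Nat.card_congr (Equiv.subtypeEquivRight fun i => by push_cast; omega)
  · rw [coeff_odd_sq, coeff_paritySeries]
    have : IsEmpty {i // 2 * e i = ((2 * m + 1 : ℕ) : ℤ)} := ⟨fun x => by have := x.2; omega⟩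
    rw [Nat.card_of_isEmpty, Nat.cast_zero]

theorem paritySeries_equiv {ι κ : Type*} (σ : ι ≃ κ) {e : ι → ℤ} {f : κ → ℤ}
    (h : ∀ i, f (σ i) = e i) : paritySeries e = paritySeries f := by
  rw [paritySeries, paritySeries, countSeries_equiv σ h]

theorem paritySeries_mul {ι κ : Type*} {e : ι → ℤ} {f : κ → ℤ}
    (he : ProperExponent e) (hf : ProperExponent f) :
    paritySeries e * paritySeries f = paritySeries fun x : ι × κ => e x.1 + f x.2 := by
  simp only [paritySeries]
  rw [← map_mul, countSeries_mul he hf]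

theorem X_pow_mul_paritySeries {ι : Type*} {e : ι → ℤ} (he : ∀ i, 0 ≤ e i) (k : ℕ) :
    X ^ k * paritySeries e = paritySeries fun i => e i + k := by
  simp only [paritySeries]
  rw [← X_pow_mul_countSeries he, map_mul, map_pow, map_X]

theorem ProperExponent.const_mul {ι : Type*} {e : ι → ℤ} (he : ProperExponent e) {c : ℤ}
    (hc : 0 < c) : ProperExponent fun i => c * e i where
  nonneg i := mul_nonneg hc.le (he.nonneg i)
  finite N := by
    by_cases h : ∃ M : ℕ, (N : ℤ) = c * M
    · obtain ⟨M, hM⟩ := h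
      have := he.finite M
      refine Finite.of_equiv _ (Equiv.subtypeEquivRight (p := fun i => e i = M) fun i => ?_)
      rw [hM, mul_right_inj' hc.ne']
    · have : IsEmpty {i // c * e i = N} := ⟨fun x => h ⟨(e x.1).toNat, by
        rw [Int.toNat_of_nonneg (he.nonneg _), x.2]⟩⟩
      infer_instance

/-- The slack 1 is needed for the triangular numbers, which vanish at -1 and equal 1 at -2. -/
theorem properExponent_of_abs_le {e : ℤ → ℤ} (h : ∀ n, |n| ≤ e n + 1) (h0 : ∀ n, 0 ≤ e n) :
    ProperExponent e where
  nonneg := h0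
  finite N := by
    refine ((Set.finite_Icc (-(N + 1 : ℤ)) (N + 1)).subset fun n hn => ?_).to_subtype
    have hn : e n = N := hn
    have := h n
    rw [hn, abs_le] at this
    exact this

/-! ### Splitting sums over the integers -/

/-- Integers as even integers `2 n` and odd integers `-2 n - 1`. -/
def evenOddEquiv : ℤ ⊕ ℤ ≃ ℤ where
  toFun := Sum.elim (fun n => 2 * n) (fun n => -2 * n - 1)
  invFun n := if n % 2 = 0 then Sum.inl (n / 2) else Sum.inr ((-1 - n) / 2)
  left_inv := by
    rintro (n | n)
    · simp
    · have : ¬ (-2 * n - 1) % 2 = 0 := by omega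
      simp only [Sum.elim_inr, this, if_false, Sum.inr.injEq]
      omega
  right_inv n := by
    simp only
    split_ifs <;> simp only [Sum.elim_inl, Sum.elim_inr] <;> omega

theorem countSeries_even_add_odd {e : ℤ → ℤ} (he : ProperExponent e) :
    countSeries e = countSeries (fun n => e (2 * n)) + countSeries (fun n => e (-2 * n - 1)) := by
  rw [← countSeries_equiv evenOddEquiv (e := fun i => e (evenOddEquiv i)) fun _ => rfl,
    countSeries_sumElim (ProperExponent.equiv evenOddEquiv (fun _ => rfl) he)]
  rfl

theorem paritySeries_even_add_odd {e : ℤ → ℤ} (he : ProperExponent e) :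
    paritySeries e
      = paritySeries (fun n => e (2 * n)) + paritySeries (fun n => e (-2 * n - 1)) := by
  simp only [paritySeries]
  rw [countSeries_even_add_odd he, map_add]

theorem countSeries_nonneg_add_neg {e : ℤ → ℤ} (he : ProperExponent e) :
    countSeries e
      = countSeries (fun n : ℕ => e n) + countSeries (fun n : ℕ => e (-1 - n)) := by
  rw [← countSeries_equiv Equiv.intEquivNatSumNat.symm
      (e := fun i => e (Equiv.intEquivNatSumNat.symm i)) fun _ => rfl,
    countSeries_sumElim (ProperExponent.equiv Equiv.intEquivNatSumNat.symm (fun _ => rfl) he)]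
  congr 2
  ext n
  simp only [Equiv.intEquivNatSumNat, Equiv.coe_fn_symm_mk, Sum.elim_inr]
  congr 1
  omega

theorem countSeries_zero_add_succ {e : ℕ → ℤ} (he : ProperExponent e) (h0 : e 0 = 0) :
    countSeries e = 1 + countSeries (fun n => e (n + 1)) := by
  rw [← countSeries_equiv Equiv.natSumPUnitEquivNat.{0}
      (e := fun i => e (Equiv.natSumPUnitEquivNat i)) fun _ => rfl,
    countSeries_sumElim (ProperExponent.equiv Equiv.natSumPUnitEquivNat (fun _ => rfl) he),
    add_comm]
  congr 1
  have h1 (i : PUnit.{1}) : e (Equiv.natSumPUnitEquivNat (Sum.inr i)) = 0 := h0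
  ext N
  rw [coeff_countSeries, coeff_one]
  split_ifs with h
  · subst h
    rw [Nat.card_congr (Equiv.subtypeUnivEquiv fun i => (h1 i).trans Nat.cast_zero.symm)]
    simp
  · have : IsEmpty {i : PUnit.{1} // e (Equiv.natSumPUnitEquivNat (Sum.inr i)) = N} := ⟨fun x => by
      have := x.2
      rw [h1] at this
      omega⟩
    rw [Nat.card_of_isEmpty, Nat.cast_zero]

theorem two_zmod_powerSeries : (2 : (ZMod 2)⟦X⟧) = 0 := by
  rw [← map_ofNat (C (R := ZMod 2)) 2, show (OfNat.ofNat 2 : ZMod 2) = 0 from rfl, map_zero]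

/-! ### The theta functions -/

/-- The exponent `n (5 n + 1) / 2` of the theta function `f(q ^ 2, q ^ 3)`. -/
def expA (n : ℤ) : ℤ := (5 * n ^ 2 + n) / 2

/-- The exponent `n (5 n + 3) / 2` of the theta function `f(q, q ^ 4)`. -/
def expB (n : ℤ) : ℤ := (5 * n ^ 2 + 3 * n) / 2

/-- The exponent `n (5 n + 4)` of the theta function `f(q, q ^ 9)`. -/
def expF (n : ℤ) : ℤ := 5 * n ^ 2 + 4 * n

/-- The exponent `n (5 n + 2)` of the theta function `f(q ^ 3, q ^ 7)`. -/
def expK (n : ℤ) : ℤ := 5 * n ^ 2 + 2 * n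

/-- The triangular numbers. -/
def triangle (n : ℤ) : ℤ := (n ^ 2 + n) / 2

theorem even_sq_add_self (n : ℤ) : (2 : ℤ) ∣ n ^ 2 + n := by
  obtain ⟨m, rfl | rfl⟩ := Int.even_or_odd' n
  · exact ⟨2 * m ^ 2 + m, by ring⟩
  · exact ⟨2 * m ^ 2 + 3 * m + 1, by ring⟩

theorem two_mul_triangle (n : ℤ) : 2 * triangle n = n ^ 2 + n :=
  Int.mul_ediv_cancel' (even_sq_add_self n)

theorem two_mul_expA (n : ℤ) : 2 * expA n = 5 * n ^ 2 + n := by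
  refine Int.mul_ediv_cancel' ?_
  have := even_sq_add_self n
  omega

theorem two_mul_expB (n : ℤ) : 2 * expB n = 5 * n ^ 2 + 3 * n := by
  refine Int.mul_ediv_cancel' ?_
  have := even_sq_add_self n
  omega

theorem self_le_sq (n : ℤ) : n ≤ n ^ 2 ∧ -n ≤ n ^ 2 := by
  constructor
  · exact Int.le_self_sq n
  · have := Int.le_self_sq (-n)
    rwa [neg_sq] at this

theorem proper_expA : ProperExponent expA := by
  refine properExponent_of_abs_le (fun n => ?_) fun n => ?_ <;>
    have := two_mul_expA n <;> have := self_le_sq n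
  · rw [abs_le]; omega
  · omega

theorem proper_expB : ProperExponent expB := by
  refine properExponent_of_abs_le (fun n => ?_) fun n => ?_ <;>
    have := two_mul_expB n <;> have := self_le_sq n
  · rw [abs_le]; omega
  · omega

theorem proper_expF : ProperExponent expF := by
  refine properExponent_of_abs_le (fun n => ?_) fun n => ?_ <;>
    have := self_le_sq n <;> unfold expF
  · rw [abs_le]; omega
  · omega

theorem proper_expK : ProperExponent expK := by
  refine properExponent_of_abs_le (fun n => ?_) fun n => ?_ <;>
    have := self_le_sq n <;> unfold expK
  · rw [abs_le]; omega
  · omega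

theorem proper_triangle : ProperExponent triangle := by
  refine properExponent_of_abs_le (fun n => ?_) fun n => ?_ <;>
    have := two_mul_triangle n <;> have := self_le_sq n
  · obtain ⟨m, hm⟩ | ⟨m, hm⟩ : (∃ m : ℕ, n = m) ∨ ∃ m : ℕ, n = -1 - m := by
      rcases le_total 0 n with h | h
      · exact Or.inl ⟨n.toNat, by omega⟩
      · by_cases h' : n = 0
        · exact Or.inl ⟨0, by omega⟩
        · exact Or.inr ⟨(-1 - n).toNat, by omega⟩
    all_goals
      rw [abs_le]
      subst hm
      constructor <;> nlinarith [self_le_sq (m : ℤ)]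
  · omega

theorem proper_triangle_nat : ProperExponent fun n : ℕ => triangle n :=
  proper_triangle.comp_injective Nat.cast_injective

theorem triangle_neg_one_sub (n : ℤ) : triangle (-1 - n) = triangle n := by
  unfold triangle
  congr 1
  ring

/-- The involution n ↦ -1 - n preserves triangular numbers and swaps the two halves of the integers.
-/
theorem countSeries_triangle {c : ℤ} (hc : 0 < c) :
    countSeries (fun n : ℤ => c * triangle n)
      = 2 * countSeries fun n : ℕ => c * triangle n := by
  rw [countSeries_nonneg_add_neg (proper_triangle.const_mul hc)]
  simp only [triangle_neg_one_sub]
  ring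

/-- `f(q ^ 2, q ^ 3)` modulo `2`. -/
noncomputable def thetaA : (ZMod 2)⟦X⟧ := paritySeries expA

/-- `f(q, q ^ 4)` modulo `2`. -/
noncomputable def thetaB : (ZMod 2)⟦X⟧ := paritySeries expB

/-- `f(q, q ^ 9)` modulo `2`. -/
noncomputable def thetaF : (ZMod 2)⟦X⟧ := paritySeries expF

/-- `f(q ^ 3, q ^ 7)` modulo `2`. -/
noncomputable def thetaK : (ZMod 2)⟦X⟧ := paritySeries expK

/-- `ψ(q)` modulo `2`. -/
noncomputable def psi : (ZMod 2)⟦X⟧ := paritySeries fun n : ℕ => triangle n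

/-- `ψ(q ^ 5)` modulo `2`. -/
noncomputable def psiFive : (ZMod 2)⟦X⟧ := paritySeries fun n : ℕ => 5 * triangle n

theorem paritySeries_pow_four {ι : Type*} (e : ι → ℤ) :
    paritySeries e ^ 4 = paritySeries fun i => 4 * e i := by
  rw [show 4 = 2 * 2 from rfl, pow_mul, paritySeries_sq, paritySeries_sq]
  congr 1
  ext i
  ring

theorem paritySeries_pow_eight {ι : Type*} (e : ι → ℤ) :
    paritySeries e ^ 8 = paritySeries fun i => 8 * e i := by
  rw [show 8 = 4 * 2 from rfl, pow_mul, paritySeries_pow_four, paritySeries_sq]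
  congr 1
  ext i
  ring

/-! ### 2-dissections and product relations -/

theorem thetaF_dissection : thetaF = thetaK ^ 4 + X * thetaB ^ 8 := by
  rw [thetaF, paritySeries_even_add_odd proper_expF, thetaK, thetaB, paritySeries_pow_four,
    paritySeries_pow_eight, ← pow_one X, X_pow_mul_paritySeries
    (proper_expB.const_mul (by norm_num)).nonneg]
  congr 2 <;> ext n
  · unfold expF expK
    ring
  · unfold expF
    push_cast
    linear_combination -4 * two_mul_expB n

theorem thetaK_dissection : thetaK = thetaA ^ 8 + X ^ 3 * thetaF ^ 4 := by
  rw [thetaK, paritySeries_even_add_odd proper_expK, thetaF, thetaA, paritySeries_pow_four,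
    paritySeries_pow_eight, X_pow_mul_paritySeries
    (proper_expF.const_mul (by norm_num)).nonneg]
  congr 2 <;> ext n
  · unfold expK
    linear_combination -4 * two_mul_expA n
  · unfold expF expK
    push_cast
    ring

/-- The pairs `(a, b)` through the difference `a - b` and the sum `a + b`, the latter only up to
`d ↦ -1 - d` because its parity is determined by the former. -/
def diffSumEquiv : ℤ × ℤ ≃ ℤ × ℕ where
  toFun x := (x.1 - x.2, if 0 ≤ x.1 + x.2 then (x.1 + x.2).toNat else (-1 - (x.1 + x.2)).toNat)
  invFun y := if (y.2 - y.1) % 2 = 0 then ((y.2 + y.1) / 2, (y.2 - y.1) / 2)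
    else ((-1 - y.2 + y.1) / 2, (-1 - y.2 - y.1) / 2)
  left_inv := by
    rintro ⟨a, b⟩
    simp only
    split_ifs <;> ext <;> simp only <;> omega
  right_inv := by
    rintro ⟨c, j⟩
    simp only
    split_ifs <;> ext <;> simp only <;> omega

theorem triangle_diffSumEquiv (x : ℤ × ℤ) :
    triangle ((diffSumEquiv x).2 : ℕ) = triangle (x.1 + x.2) := by
  simp only [diffSumEquiv, Equiv.coe_fn_mk]
  split_ifs with h
  · rw [Int.toNat_of_nonneg h]
  · rw [Int.toNat_of_nonneg (by omega), triangle_neg_one_sub]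

/-- Modulo 2 the square doubles the exponents of A, and `expF a + 2 * expA b = expB (a - b) + 5 *
triangle (a + b)`. -/
theorem thetaF_mul_thetaA_sq : thetaF * thetaA ^ 2 = thetaB * psiFive := by
  rw [thetaF, thetaA, thetaB, psiFive, paritySeries_sq,
    paritySeries_mul proper_expF (proper_expA.const_mul (by norm_num)),
    paritySeries_mul proper_expB (proper_triangle_nat.const_mul (by norm_num))]
  refine paritySeries_equiv diffSumEquiv fun x => ?_
  rw [triangle_diffSumEquiv]
  refine mul_left_cancel₀ (two_ne_zero (α := ℤ)) ?_
  simp only [diffSumEquiv, Equiv.coe_fn_mk, expF]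
  linear_combination two_mul_expB (x.1 - x.2) + 5 * two_mul_triangle (x.1 + x.2)
    - 2 * two_mul_expA x.2

theorem thetaB_sq_mul_thetaK : thetaB ^ 2 * thetaK = thetaA * psiFive := by
  rw [thetaK, thetaA, thetaB, psiFive, paritySeries_sq,
    paritySeries_mul (proper_expB.const_mul (by norm_num)) proper_expK,
    paritySeries_mul proper_expA (proper_triangle_nat.const_mul (by norm_num))]
  refine paritySeries_equiv diffSumEquiv fun x => ?_
  rw [triangle_diffSumEquiv]
  refine mul_left_cancel₀ (two_ne_zero (α := ℤ)) ?_
  simp only [diffSumEquiv, Equiv.coe_fn_mk, expK]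
  linear_combination two_mul_expA (x.1 - x.2) + 5 * two_mul_triangle (x.1 + x.2)
    - 2 * two_mul_expB x.1

/-! ### Lattice sums split modulo 5 -/

/-- The pairs `(s, t)` sorted by the residue `r` of `t - l s` modulo `5`. -/
def residueEquiv (l : ℤ) : Fin 5 × (ℤ × ℤ) ≃ ℤ × ℤ where
  toFun x := (x.2.1, l * x.2.1 + (x.1 : ℕ) + 5 * x.2.2)
  invFun y := (⟨((y.2 - l * y.1) % 5).toNat, by omega⟩, y.1, (y.2 - l * y.1) / 5)
  left_inv := by
    rintro ⟨⟨r, hr⟩, s, k⟩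
    simp only
    ext <;> simp only <;> omega
  right_inv := by
    rintro ⟨s, t⟩
    simp only
    ext <;> simp only
    omega

theorem countSeries_residues (l : ℤ) {e : ℤ × ℤ → ℤ} (he : ProperExponent e) :
    countSeries e
      = countSeries (fun x : ℤ × ℤ => e (x.1, l * x.1 + 0 + 5 * x.2))
        + countSeries (fun x : ℤ × ℤ => e (x.1, l * x.1 + 1 + 5 * x.2))
        + countSeries (fun x : ℤ × ℤ => e (x.1, l * x.1 + 2 + 5 * x.2))
        + countSeries (fun x : ℤ × ℤ => e (x.1, l * x.1 + 3 + 5 * x.2))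
        + countSeries (fun x : ℤ × ℤ => e (x.1, l * x.1 + 4 + 5 * x.2)) := by
  rw [← countSeries_equiv (residueEquiv l) (e := fun i => e (residueEquiv l i)) fun _ => rfl,
    countSeries_fin_prod (ProperExponent.equiv (residueEquiv l) (fun _ => rfl) he),
    Fin.sum_univ_five]
  rfl

theorem ofNat_powerSeries_ne_zero (n : ℕ) [n.AtLeastTwo] :
    (OfNat.ofNat n : ℤ⟦X⟧) ≠ 0 := fun h =>
  OfNat.ofNat_ne_zero (R := ℤ) n
    (C_injective ((map_ofNat C n).trans (h.trans (map_zero C).symm)))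

/-- The affine permutation `(s, k) ↦ (ε k + c, δ s + m k + d)` of the integer lattice. -/
def shearEquiv (ε δ : ℤˣ) (c m d : ℤ) : ℤ × ℤ ≃ ℤ × ℤ where
  toFun x := (ε * x.2 + c, δ * x.1 + m * x.2 + d)
  invFun y := (δ * (y.2 - d - m * (ε * (y.1 - c))), ε * (y.1 - c))
  left_inv x := by
    have h1 : (ε : ℤ) * ε = 1 := Int.units_coe_mul_self ε
    have h2 : (δ : ℤ) * δ = 1 := Int.units_coe_mul_self δ
    ext
    · simp only
      linear_combination x.1 * h2 - δ * m * x.2 * h1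
    · simp only
      linear_combination x.2 * h1
  right_inv y := by
    have h1 : (ε : ℤ) * ε = 1 := Int.units_coe_mul_self ε
    have h2 : (δ : ℤ) * δ = 1 := Int.units_coe_mul_self δ
    ext
    · simp only
      linear_combination (y.1 - c) * h1
    · simp only
      linear_combination (y.2 - d - m * (ε * (y.1 - c))) * h2

theorem countSeries_shear (ε δ : ℤˣ) (c m d : ℤ) {f g : ℤ → ℤ} {h : ℤ × ℤ → ℤ}
    (hf : ProperExponent f) (hg : ProperExponent g) (k : ℕ)
    (H : ∀ x, 2 * h x = 2 * f (ε * x.2 + c) + 2 * g (δ * x.1 + m * x.2 + d) + 2 * k) :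
    countSeries h = X ^ k * (countSeries f * countSeries g) := by
  rw [countSeries_mul hf hg, X_pow_mul_countSeries (hf.add hg).nonneg]
  refine countSeries_equiv (shearEquiv ε δ c m d) fun x => ?_
  have := H x
  simp only [shearEquiv, Equiv.coe_fn_mk]
  omega

/-- The form s^2 + t^2 becomes diagonal on t ≡ 2s (mod 5), as 1 + 2^2 = 5. Summing over all integers
s, t counts everything four times, so the identity is proved over ℤ, where 4 can be cancelled,
before reducing modulo 2. -/
theorem countSeries_mul_eq_psi_sq :
    countSeries expA * countSeries expB
        + X * (countSeries fun n : ℕ => 5 * triangle n) ^ 2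
      = (countSeries fun n : ℕ => 1 * triangle n) ^ 2 := by
  have hT := proper_triangle.const_mul (c := 5) (by norm_num)
  have hP := proper_triangle.const_mul (c := 1) (by norm_num)
  have key := countSeries_residues 2 (hP.add hP)
  rw [← countSeries_mul hP hP] at key
  -- Residues 0, 1, 2, 4 each contribute f(q^2, q^3) f(q, q^4); residue 3 contributes q times the
  -- square of the two-sided sum, which is 2ψ(q^5).
  rw [countSeries_shear (-1) 1 0 2 0 proper_expA proper_expB 0,
    countSeries_shear 1 (-1) 0 (-2) (-1) proper_expA proper_expB 0,
    countSeries_shear 1 1 0 2 1 proper_expB proper_expA 0,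
    countSeries_shear 1 1 0 2 1 hT hT 1,
    countSeries_shear (-1) (-1) (-1) (-2) (-2) proper_expB proper_expA 0,
    countSeries_triangle (by norm_num), countSeries_triangle (by norm_num)] at key
  · refine mul_left_cancel₀ (ofNat_powerSeries_ne_zero 4) ?_
    linear_combination -key
  all_goals
    rintro ⟨s, k⟩
    simp only [two_mul_expA, two_mul_expB, mul_left_comm (2 : ℤ), mul_add, two_mul_triangle]
    push_cast
    ring

/-- Here 4s^2 + t^2 is diagonalised on t ≡ s (mod 5), as 4 + 1 = 5. The class t ≡ s + 2 involves two
two-sided triangular sums, so it keeps a factor 2 after the common 2 is cancelled, and it vanishes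
modulo 2. -/
theorem countSeries_mul_psi :
    countSeries (fun n => 4 * expA n) * countSeries expA
        + X * (countSeries (fun n => 4 * expB n) * countSeries expB)
        + 2 * X ^ 3 * ((countSeries fun n : ℕ => 20 * triangle n)
          * countSeries fun n : ℕ => 5 * triangle n)
      = countSeries (fun n : ℤ => 2 * n ^ 2) * countSeries fun n : ℕ => 1 * triangle n := by
  have hT := proper_triangle.const_mul (c := 5) (by norm_num)
  have hT4 := proper_triangle.const_mul (c := 20) (by norm_num)
  have hP := proper_triangle.const_mul (c := 1) (by norm_num)
  have hA := proper_expA.const_mul (c := 4) (by norm_num)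
  have hB := proper_expB.const_mul (c := 4) (by norm_num)
  have hQ : ProperExponent fun n : ℤ => 2 * n ^ 2 := by
    refine properExponent_of_abs_le (fun n => ?_) fun n => by positivity
    have := self_le_sq n
    rw [abs_le]
    omega
  have key := countSeries_residues 1 (hQ.add hP)
  rw [← countSeries_mul hQ hP] at key
  rw [countSeries_shear 1 1 0 1 0 hA proper_expA 0,
    countSeries_shear 1 1 0 1 0 hB proper_expB 1,
    countSeries_shear 1 1 0 1 0 hT4 hT 3,
    countSeries_shear (-1) (-1) (-1) (-1) (-1) hB proper_expB 1,
    countSeries_shear (-1) (-1) (-1) (-1) (-1) hA proper_expA 0,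
    countSeries_triangle (by norm_num), countSeries_triangle (by norm_num),
    countSeries_triangle (by norm_num)] at key
  · refine mul_left_cancel₀ (ofNat_powerSeries_ne_zero 2) ?_
    linear_combination -key
  all_goals
    rintro ⟨s, k⟩
    simp only [two_mul_expA, two_mul_expB, mul_left_comm (2 : ℤ), mul_add, two_mul_triangle]
    push_cast
    ring

/-- The indices n and -n cancel modulo 2, leaving only n = 0. -/
theorem paritySeries_two_mul_sq : paritySeries (fun n : ℤ => 2 * n ^ 2) = 1 := by
  have hQ : ProperExponent fun n : ℤ => 2 * n ^ 2 := by
    refine properExponent_of_abs_le (fun n => ?_) fun n => by positivity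
    have := self_le_sq n
    rw [abs_le]
    omega
  have h1 : (fun n : ℕ => 2 * (-1 - n : ℤ) ^ 2) = fun n : ℕ => 2 * (((n + 1 : ℕ) : ℤ)) ^ 2 := by
    ext n
    push_cast
    ring
  rw [paritySeries, countSeries_nonneg_add_neg hQ, countSeries_zero_add_succ
    (hQ.comp_injective Nat.cast_injective) (by norm_num), h1, map_add, map_add, map_one]
  linear_combination (PowerSeries.map (Int.castRingHom (ZMod 2))
    (countSeries fun n : ℕ => 2 * (((n + 1 : ℕ) : ℤ)) ^ 2)) * two_zmod_powerSeries

theorem thetaA_mul_thetaB : thetaA * thetaB + X * psiFive ^ 2 = psi ^ 2 := by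
  have h := congrArg (PowerSeries.map (Int.castRingHom (ZMod 2))) countSeries_mul_eq_psi_sq
  simp only [one_mul, map_add, map_mul, map_pow, map_X] at h
  exact h

/-- Modulo 2, A(q^4) = A^4 and B(q^4) = B^4, while the factor φ(q^2) becomes 1. -/
theorem thetaA_pow_five_add : thetaA ^ 5 + X * thetaB ^ 5 = psi := by
  have h := congrArg (PowerSeries.map (Int.castRingHom (ZMod 2))) countSeries_mul_psi
  simp only [one_mul, map_add, map_mul, map_pow, map_X, map_ofNat, two_zmod_powerSeries, zero_mul,
    add_zero] at h
  have hφ := paritySeries_two_mul_sq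
  rw [paritySeries] at hφ
  rw [hφ, one_mul] at h
  have hA := paritySeries_pow_four expA
  have hB := paritySeries_pow_four expB
  rw [paritySeries, paritySeries] at hA hB
  rw [← hA, ← hB] at h
  simp only [thetaA, thetaB, psi, paritySeries]
  rw [← h]
  ring

/-! ### The false theta function and its reciprocal modulo 2 -/

theorem intCast_finsum_neg_one_pow (w i : ℕ → ℕ) (N : ℕ) (h : {n | N = w n}.Finite) :
    ((∑ᶠ n, if N = w n then (-1 : ℤ) ^ i n else 0 : ℤ) : ZMod 2)
      = (Nat.card {n // w n = N} : ZMod 2) := by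
  rw [finsum_eq_sum_of_support_subset (s := h.toFinset) _ fun n hn => by
    simp only [Function.mem_support, ne_eq, ite_eq_right_iff, Classical.not_imp] at hn
    simpa using hn.1]
  have h1 : Nat.card {n // w n = N} = h.toFinset.card := by
    rw [← Nat.card_eq_card_finite_toFinset h]
    exact Nat.card_congr (Equiv.subtypeEquivRight fun n => eq_comm)
  rw [h1, Int.cast_sum, Finset.card_eq_sum_ones, Nat.cast_sum]
  refine Finset.sum_congr rfl fun n hn => ?_
  have hn : N = w n := by simpa using hn
  rw [if_pos hn]
  push_cast
  rw [show (-1 : ZMod 2) = 1 from rfl, one_pow]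

theorem natCast_triangle (n : ℕ) : ((n * (n + 1) / 2 : ℕ) : ℤ) = triangle n := by
  unfold triangle
  push_cast
  congr 1
  ring

theorem natCast_triangle_pred (n : ℕ) : ((n * (n - 1) / 2 : ℕ) : ℤ) = triangle (n - 1) := by
  cases n with
  | zero => rfl
  | succ m =>
    rw [mul_comm, Nat.add_sub_cancel, natCast_triangle]
    congr 1
    push_cast
    ring

/-- The exponent 9n(n+1)/2 + n(n-1)/2 is 5n^2 + 4n; the subtracted sum supplies the negative indices
-1 - m. -/
theorem map_falseTheta :
    PowerSeries.map (Int.castRingHom (ZMod 2)) (falseTheta (-(X : ℤ⟦X⟧) ^ 9) ((X : ℤ⟦X⟧) ^ 1))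
      = thetaF := by
  ext N
  have hN := falseTheta_finite 9 1 (by norm_num) le_rfl N
  simp only [coeff_falseTheta_term] at hN
  have hfin (w i : ℕ → ℕ)
      (h : (Function.support fun n => if N = w n then (-1 : ℤ) ^ i n else 0).Finite) :
      {n | N = w n}.Finite := h.subset fun n hn => by
    have hn : N = w n := hn
    rw [Function.mem_support, if_pos hn]
    exact pow_ne_zero _ (by norm_num)
  rw [thetaF, paritySeries, countSeries_nonneg_add_neg proper_expF, coeff_map, coeff_map,
    falseTheta, coeff_mk, map_add, coeff_countSeries, coeff_countSeries]
  simp only [coeff_falseTheta_term, eq_intCast]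
  rw [Int.cast_sub, intCast_finsum_neg_one_pow _ _ _ (hfin _ _ hN.1),
    intCast_finsum_neg_one_pow _ _ _ (hfin _ _ hN.2), sub_eq_add_neg,
    show ∀ a : ZMod 2, -a = a by decide]
  push_cast
  congr 2
  · refine Nat.card_congr (Equiv.subtypeEquivRight fun n => ?_)
    have h1 := natCast_triangle n
    have h2 := natCast_triangle_pred n
    have h3 := two_mul_triangle n
    have h4 := two_mul_triangle (n - 1)
    have h5 : ((n : ℤ) - 1) ^ 2 = (n : ℤ) ^ 2 - 2 * n + 1 := by ring
    unfold expF
    omega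
  · refine Nat.card_congr (Equiv.subtypeEquivRight fun n => ?_)
    have h1 := natCast_triangle n
    have h2 : (((n + 1) * (n + 2) / 2 : ℕ) : ℤ) = triangle (n + 1) := by
      rw [show n + 2 = n + 1 + 1 from rfl, natCast_triangle]
      push_cast
      rfl
    have h3 := two_mul_triangle n
    have h4 := two_mul_triangle (n + 1)
    have h5 : ((n : ℤ) + 1) ^ 2 = (n : ℤ) ^ 2 + 2 * n + 1 := by ring
    have h6 : (-1 - (n : ℤ)) ^ 2 = (n : ℤ) ^ 2 + 2 * n + 1 := by ring
    unfold expF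
    omega

/-- The reduction modulo `2` of the generating function of `c_{9,1}`. -/
noncomputable def recipSeries : (ZMod 2)⟦X⟧ :=
  PowerSeries.map (Int.castRingHom (ZMod 2)) (PowerSeries.mk (recipFalseThetaCoeff 9 1))

theorem thetaF_mul_recipSeries : thetaF * recipSeries = 1 := by
  rw [← map_falseTheta, recipSeries, ← map_mul,
    falseTheta_mul_mk_recip 9 1 (by norm_num) le_rfl, map_one]

theorem coeff_recipSeries (n : ℕ) :
    coeff n recipSeries = (recipFalseThetaCoeff 9 1 n : ZMod 2) := by
  simp [recipSeries]

theorem zmod_two_eq_one {a : ZMod 2} (h : a ≠ 0) : a = 1 := by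
  revert a
  decide

theorem constantCoeff_thetaF : constantCoeff thetaF = 1 := by
  refine zmod_two_eq_one fun h => ?_
  have := congrArg constantCoeff thetaF_mul_recipSeries
  rw [map_mul, h, zero_mul, map_one] at this
  exact zero_ne_one this

theorem constantCoeff_thetaK : constantCoeff thetaK = 1 := by
  refine zmod_two_eq_one fun h => ?_
  have := congrArg constantCoeff thetaF_dissection
  simp [h, constantCoeff_thetaF] at this

theorem constantCoeff_thetaA : constantCoeff thetaA = 1 := by
  refine zmod_two_eq_one fun h => ?_
  have := congrArg constantCoeff thetaK_dissection
  simp [h, constantCoeff_thetaK] at this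

theorem constantCoeff_psi : constantCoeff psi = 1 := by
  simp [← thetaA_pow_five_add, constantCoeff_thetaA]

theorem constantCoeff_thetaB : constantCoeff thetaB = 1 := by
  have := congrArg constantCoeff thetaA_mul_thetaB
  simpa [constantCoeff_thetaA, constantCoeff_psi] using this

theorem constantCoeff_psiFive : constantCoeff psiFive = 1 := by
  have := congrArg constantCoeff thetaF_mul_thetaA_sq
  simpa [constantCoeff_thetaA, constantCoeff_thetaF, constantCoeff_thetaB] using this.symm

theorem ne_zero_of_constantCoeff {f : (ZMod 2)⟦X⟧} (h : constantCoeff f = 1) : f ≠ 0 := by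
  rintro rfl
  simp at h

theorem thetaA_ne_zero : thetaA ≠ 0 := ne_zero_of_constantCoeff constantCoeff_thetaA

theorem thetaB_ne_zero : thetaB ≠ 0 := ne_zero_of_constantCoeff constantCoeff_thetaB

/-! ### Algebraic consequences of the theta relations -/

theorem psiFive_mul_eq :
    psiFive * (psi ^ 2 + X * (thetaA * thetaB) ^ 5) = (thetaA * thetaB) ^ 2 * psi ^ 3 := by
  have h1 := thetaF_dissection
  have h2 := thetaK_dissection
  have h3 := thetaF_mul_thetaA_sq
  have h4 := thetaB_sq_mul_thetaK
  have h5 := thetaA_pow_five_add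
  have two := two_zmod_powerSeries
  have hP := ne_zero_of_constantCoeff constantCoeff_psi
  generalize thetaA = A, thetaB = B, thetaF = F, thetaK = K, psi = P, psiFive = T at *
  -- Substituting the product relations into the two dissections eliminates F and K.
  have e1 : B ^ 9 * T = A ^ 6 * T ^ 4 + X * A ^ 2 * B ^ 16 := by
    calc B ^ 9 * T = B ^ 8 * (B * T) := by ring
      _ = B ^ 8 * (F * A ^ 2) := by rw [h3]
      _ = A ^ 2 * (B ^ 2 * K) ^ 4 + X * A ^ 2 * B ^ 16 := by
        linear_combination B ^ 8 * A ^ 2 * h1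
      _ = _ := by rw [h4]; ring
  have e2 : A ^ 9 * T = A ^ 16 * B ^ 2 + X ^ 3 * B ^ 6 * T ^ 4 := by
    calc A ^ 9 * T = A ^ 8 * (A * T) := by ring
      _ = A ^ 8 * (B ^ 2 * K) := by rw [h4]
      _ = A ^ 16 * B ^ 2 + X ^ 3 * B ^ 2 * (F * A ^ 2) ^ 4 := by
        linear_combination B ^ 2 * A ^ 8 * h2
      _ = _ := by rw [h3]; ring
  -- The multipliers are chosen so that the terms in T^4 cancel.
  have e3 : T * (A ^ 15 - X ^ 3 * B ^ 15) = A ^ 2 * B ^ 2 * (A ^ 20 - X ^ 4 * B ^ 20) := by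
    linear_combination A ^ 6 * e2 - X ^ 3 * B ^ 6 * e1
  -- With a = A^5 and b = qB^5, so P = a + b, the next two facts are a^4 + b^4 = (a+b)^4 and a^3 +
  -- b^3 = (a+b)((a+b)^2 + ab) modulo 2.
  have e4 : P ^ 4 = A ^ 20 - X ^ 4 * B ^ 20 := by
    rw [← h5]
    linear_combination (2 * A ^ 15 * X * B ^ 5 + 3 * A ^ 10 * X ^ 2 * B ^ 10
      + 2 * A ^ 5 * X ^ 3 * B ^ 15 + X ^ 4 * B ^ 20) * two
  have e5 : P * (P ^ 2 + X * (A * B) ^ 5) = A ^ 15 - X ^ 3 * B ^ 15 := by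
    rw [← h5]
    linear_combination (2 * A ^ 10 * X * B ^ 5 + 2 * A ^ 5 * X ^ 2 * B ^ 10
      + X ^ 3 * B ^ 15) * two
  refine mul_left_cancel₀ hP ?_
  linear_combination e3 + T * e5 - A ^ 2 * B ^ 2 * e4

/-- Put g = AB. Multiplying `psiFive_mul_eq` by T and replacing qT^2 by P^2 + g gives a polynomial
relation that factors as (PT + g^3)(PT + g^3 + g^2 P^2) = 0. -/
theorem psi_mul_psiFive : psi * psiFive = (thetaA * thetaB) ^ 3 := by
  have h1 := psiFive_mul_eq
  have h2 := thetaA_mul_thetaB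
  have two := two_zmod_powerSeries
  have h : (psi * psiFive - (thetaA * thetaB) ^ 3)
      * (psi * psiFive + (thetaA * thetaB) ^ 3 + (thetaA * thetaB) ^ 2 * psi ^ 2) = 0 := by
    generalize thetaA * thetaB = g at *
    linear_combination psiFive * h1 - g ^ 5 * h2 + (g ^ 2 * psi ^ 3 * psiFive - g ^ 5 * psi ^ 2) * two
  rcases mul_eq_zero.1 h with h | h
  · exact sub_eq_zero.1 h
  -- The second factor has constant term 1 + 1 + 1 = 1, so it cannot vanish.
  · have := congrArg constantCoeff h
    simp [constantCoeff_thetaA, constantCoeff_thetaB, constantCoeff_psi,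
      constantCoeff_psiFive] at this
    exact absurd this (by decide)

/-- After multiplication by A^2 B^2 the left side is T(A^5 + qB^5) = PT = (AB)^3. -/
theorem thetaA_sq_mul_thetaK_add :
    thetaA ^ 2 * thetaK + X * thetaF * thetaB ^ 2 = thetaA * thetaB := by
  have h : thetaA ^ 2 * thetaB ^ 2 ≠ 0 :=
    mul_ne_zero (pow_ne_zero _ thetaA_ne_zero) (pow_ne_zero _ thetaB_ne_zero)
  refine mul_left_cancel₀ h ?_
  linear_combination thetaA ^ 4 * thetaB_sq_mul_thetaK + X * thetaB ^ 4 * thetaF_mul_thetaA_sq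
    + psiFive * thetaA_pow_five_add + psi_mul_psiFive

theorem thetaF_mul_psi : thetaF * (thetaA * psi) = (thetaA * thetaB) ^ 2 * thetaB ^ 2 := by
  refine mul_left_cancel₀ (pow_ne_zero 2 thetaA_ne_zero) ?_
  linear_combination thetaA * psi * thetaF_mul_thetaA_sq + thetaA * thetaB * psi_mul_psiFive

theorem thetaF_mul_thetaK_mul : thetaF * thetaK * (thetaA * thetaB) = psiFive ^ 2 := by
  refine mul_left_cancel₀ (mul_ne_zero thetaA_ne_zero thetaB_ne_zero) ?_
  linear_combination thetaB ^ 2 * thetaK * thetaF_mul_thetaA_sq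
    + thetaB * psiFive * thetaB_sq_mul_thetaK

/-- After multiplication by A^2 the left side is AB T^2 = P^2 T^2 + qT^4, where PT = (AB)^3 and T^2
= FK·AB. -/
theorem thetaF_mul_psiFive :
    thetaF * (thetaA * psiFive)
      = thetaB ^ 2 * ((thetaA * thetaB) ^ 4 + X * (thetaF * thetaK) ^ 2) := by
  refine mul_left_cancel₀ (pow_ne_zero 2 thetaA_ne_zero) ?_
  linear_combination thetaA * psiFive * thetaF_mul_thetaA_sq
    + psiFive ^ 2 * thetaA_mul_thetaB - X * psiFive ^ 4 * two_zmod_powerSeries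
    + (psi * psiFive + (thetaA * thetaB) ^ 3) * psi_mul_psiFive
    - X * (thetaF * thetaK * (thetaA * thetaB) + psiFive ^ 2) * thetaF_mul_thetaK_mul

/-! ### Dissecting the reciprocal modulo 8 -/

theorem coeff_even_sq_add (a b : (ZMod 2)⟦X⟧) (m : ℕ) :
    coeff (2 * m) (a ^ 2 + X * b ^ 2) = coeff m a := by
  rw [map_add, coeff_even_sq]
  cases m with
  | zero => simp
  | succ m => rw [show 2 * (m + 1) = 2 * m + 1 + 1 by ring, coeff_succ_X_mul, coeff_odd_sq, add_zero]

theorem coeff_odd_sq_add (a b : (ZMod 2)⟦X⟧) (m : ℕ) :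
    coeff (2 * m + 1) (a ^ 2 + X * b ^ 2) = coeff m b := by
  rw [map_add, coeff_odd_sq, coeff_succ_X_mul, coeff_even_sq, zero_add]

/-- Write G = F^3 G^4 and expand F^3 = (K^4 + qB^8)^3. As fourth powers are series in q^4, the class
2 (mod 4) is q^2 K^4 B^16 G^4 = q^2 (K B^4 G)^4. -/
theorem coeff_recipSeries_four_mul_add_two (m : ℕ) :
    coeff (4 * m + 2) recipSeries = coeff m (thetaK * thetaB ^ 4 * recipSeries) := by
  have h : recipSeries = ((thetaK ^ 3 * recipSeries) ^ 2
        + X * (thetaK * thetaB ^ 4 * recipSeries) ^ 2) ^ 2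
      + X * (thetaK ^ 4 * thetaB ^ 4 * recipSeries ^ 2 + X * thetaB ^ 12 * recipSeries ^ 2) ^ 2 := by
    have h1 := thetaF_dissection
    have h2 := thetaF_mul_recipSeries
    generalize thetaB = B, thetaF = F, thetaK = K, recipSeries = G at *
    have h3 : G = F ^ 3 * G ^ 4 := by
      calc G = (1 : (ZMod 2)⟦X⟧) ^ 3 * G := by ring
        _ = (F * G) ^ 3 * G := by rw [h2]
        _ = _ := by ring
    linear_combination h3
      + G ^ 4 * (F ^ 2 + F * (K ^ 4 + X * B ^ 8) + (K ^ 4 + X * B ^ 8) ^ 2) * h1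
  conv_lhs => rw [h]
  rw [show 4 * m + 2 = 2 * (2 * m + 1) by ring, coeff_even_sq_add, coeff_odd_sq_add]

/-- Write K B^4 G = K F B^4 G^2 and insert both dissections. The even part contains A^8 K^4 + q^4
F^4 B^8 = (A^2 K + qFB^2)^4 = (AB)^4; the odd part contains A^8 B^8 + q^2 (FK)^4. Both are squares,
identified by `thetaF_mul_psi` and `thetaF_mul_psiFive`. -/
theorem thetaK_mul_recipSeries_dissection :
    thetaK * thetaB ^ 4 * recipSeries
      = (thetaA * psi) ^ 2 + X * (thetaA * psiFive) ^ 2 := by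
  have h1 : thetaA * psi
      = (thetaA ^ 2 * thetaK + X * thetaF * thetaB ^ 2) ^ 2 * thetaB ^ 2 * recipSeries := by
    rw [thetaA_sq_mul_thetaK_add]
    linear_combination recipSeries * thetaF_mul_psi - thetaA * psi * thetaF_mul_recipSeries
  have h2 : thetaA * psiFive
      = thetaB ^ 2 * ((thetaA * thetaB) ^ 4 + X * (thetaF * thetaK) ^ 2) * recipSeries := by
    linear_combination recipSeries * thetaF_mul_psiFive
      - thetaA * psiFive * thetaF_mul_recipSeries
  have h3 : thetaK * thetaB ^ 4 * recipSeries
      = (thetaA ^ 8 + X ^ 3 * thetaF ^ 4) * (thetaK ^ 4 + X * thetaB ^ 8) * thetaB ^ 4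
        * recipSeries ^ 2 := by
    rw [← thetaF_dissection, ← thetaK_dissection]
    linear_combination -(thetaK * thetaB ^ 4 * recipSeries) * thetaF_mul_recipSeries
  rw [h3, h1, h2]
  have two := two_zmod_powerSeries
  generalize thetaA = A, thetaB = B, thetaF = F, thetaK = K, recipSeries = G
  linear_combination -B ^ 4 * G ^ 2 * (2 * (A ^ 2 * K) ^ 3 * (X * F * B ^ 2)
    + 3 * (A ^ 2 * K) ^ 2 * (X * F * B ^ 2) ^ 2 + 2 * (A ^ 2 * K) * (X * F * B ^ 2) ^ 3
    + X ^ 2 * (A * B) ^ 4 * (F * K) ^ 2) * two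

theorem coeff_recipSeries_eight_mul_add_two (m : ℕ) :
    coeff (8 * m + 2) recipSeries = coeff m (thetaA * psi) := by
  rw [show 8 * m + 2 = 4 * (2 * m) + 2 by ring, coeff_recipSeries_four_mul_add_two,
    thetaK_mul_recipSeries_dissection, coeff_even_sq_add]

theorem coeff_recipSeries_eight_mul_add_six (m : ℕ) :
    coeff (8 * m + 6) recipSeries = coeff m (thetaA * psiFive) := by
  rw [show 8 * m + 6 = 4 * (2 * m + 1) + 2 by ring, coeff_recipSeries_four_mul_add_two,
    thetaK_mul_recipSeries_dissection, coeff_odd_sq_add]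

/-! ### Quadratic forms and descent at p -/

theorem coeff_thetaA_mul_psi_eq_zero {m : ℕ}
    (h : ∀ x y : ℤ, x ^ 2 + 5 * y ^ 2 ≠ 40 * m + 6) : coeff m (thetaA * psi) = 0 := by
  rw [thetaA, psi, paritySeries_mul proper_expA proper_triangle_nat, coeff_paritySeries]
  have : IsEmpty {x : ℤ × ℕ // expA x.1 + triangle x.2 = m} := ⟨by
    rintro ⟨⟨a, t⟩, hx⟩
    -- Completing squares: 40 `expA a` + 1 = (10a+1)^2 and 40 `triangle t` + 5 = 5(2t+1)^2.
    refine h (10 * a + 1) (2 * t + 1) ?_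
    linear_combination 20 * (-two_mul_expA a - two_mul_triangle t) + 40 * hx⟩
  rw [Nat.card_of_isEmpty, Nat.cast_zero]

theorem coeff_thetaA_mul_psiFive_eq_zero {m : ℕ}
    (h : ∀ x y : ℤ, x ^ 2 + 25 * y ^ 2 ≠ 40 * m + 26) : coeff m (thetaA * psiFive) = 0 := by
  rw [thetaA, psiFive, paritySeries_mul proper_expA (proper_triangle_nat.const_mul (by norm_num)),
    coeff_paritySeries]
  have : IsEmpty {x : ℤ × ℕ // expA x.1 + 5 * triangle x.2 = m} := ⟨by
    rintro ⟨⟨a, t⟩, hx⟩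
    refine h (10 * a + 1) (2 * t + 1) ?_
    linear_combination 20 * (-two_mul_expA a - 5 * two_mul_triangle t) + 40 * hx⟩
  rw [Nat.card_of_isEmpty, Nat.cast_zero]

/-- If d = s^2 and y ≠ 0 modulo p, then x/(sy) would be a square root of -1, impossible for p ≡ 3
(mod 4). -/
theorem dvd_of_dvd_sq_add_mul_sq {p : ℕ} [Fact p.Prime] (hp : p % 4 = 3) {d : ℤ}
    (hd : (d : ZMod p) ≠ 0) (hsq : IsSquare (d : ZMod p)) {x y : ℤ}
    (h : (p : ℤ) ∣ x ^ 2 + d * y ^ 2) : (p : ℤ) ∣ x ∧ (p : ℤ) ∣ y := by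
  obtain ⟨s, hs⟩ := hsq
  have h0 : (x : ZMod p) ^ 2 + (d : ZMod p) * (y : ZMod p) ^ 2 = 0 := by
    exact_mod_cast (ZMod.intCast_zmod_eq_zero_iff_dvd (x ^ 2 + d * y ^ 2) p).2 h
  rw [hs] at h0 hd
  have hs0 : s ≠ 0 := fun h => hd (by rw [h, zero_mul])
  have hy : (y : ZMod p) = 0 := by
    by_contra hy
    refine ZMod.mod_four_ne_three_of_sq_eq_neg_one (p := p) (y := (x : ZMod p) / (s * y)) ?_ hp
    rw [div_pow, div_eq_iff (pow_ne_zero _ (mul_ne_zero hs0 hy))]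
    linear_combination h0
  have hx : (x : ZMod p) = 0 := by
    rw [hy] at h0
    simpa using h0
  exact ⟨(ZMod.intCast_zmod_eq_zero_iff_dvd _ p).1 hx, (ZMod.intCast_zmod_eq_zero_iff_dvd _ p).1 hy⟩

/-- Infinite descent: p divides both x and y, so p^2 can be removed from each side until a single
factor p is left. -/
theorem sq_add_mul_sq_ne {p : ℕ} [hp : Fact p.Prime] (hp4 : p % 4 = 3) {d : ℤ}
    (hd : (d : ZMod p) ≠ 0) (hsq : IsSquare (d : ZMod p)) {u : ℤ} (hu : ¬ (p : ℤ) ∣ u)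
    (k : ℕ) (x y : ℤ) : x ^ 2 + d * y ^ 2 ≠ p ^ (2 * k + 1) * u := by
  have hp0 : (p : ℤ) ≠ 0 := by exact_mod_cast hp.out.ne_zero
  induction k generalizing x y with
  | zero =>
    intro h
    obtain ⟨⟨a, rfl⟩, b, rfl⟩ := dvd_of_dvd_sq_add_mul_sq hp4 hd hsq
      (x := x) (y := y) ⟨u, by rw [h]; ring⟩
    refine hu ⟨a ^ 2 + d * b ^ 2, mul_left_cancel₀ hp0 ?_⟩
    linear_combination -h
  | succ k ih =>
    intro h
    obtain ⟨⟨a, rfl⟩, b, rfl⟩ :=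
      dvd_of_dvd_sq_add_mul_sq hp4 hd hsq
        (x := x) (y := y) ⟨p ^ (2 * k + 2) * u, by rw [h]; ring⟩
    refine ih a b (mul_left_cancel₀ (pow_ne_zero 2 hp0) ?_)
    linear_combination h

/-- Quadratic reciprocity, 5 being 1 modulo 4; the residues 1 and 4 are squares modulo 5. -/
theorem isSquare_five_zmod {p : ℕ} [Fact p.Prime] (hp : p % 5 = 1 ∨ p % 5 = 4) (h2 : p ≠ 2) :
    IsSquare (5 : ZMod p) := by
  have : Fact (Nat.Prime 5) := ⟨by norm_num⟩
  have h := ZMod.exists_sq_eq_prime_iff_of_mod_four_eq_one (p := 5) (q := p) rfl h2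
  rw [Nat.cast_ofNat, ← ZMod.natCast_mod p 5] at h
  refine h.1 ?_
  rcases hp with hp | hp <;> rw [hp]
  · exact ⟨1, rfl⟩
  · exact ⟨2, rfl⟩

theorem pow_mod_forty {p : ℕ} (hmod : p % 20 = 11 ∨ p % 20 = 19) (k : ℕ) :
    p ^ (2 * k + 2) % 40 = 1 := by
  have h : p ^ 2 % 40 = 1 := by
    have : p % 40 = 11 ∨ p % 40 = 31 ∨ p % 40 = 19 ∨ p % 40 = 39 := by omega
    rw [Nat.pow_mod]
    rcases this with h | h | h | h <;> rw [h]
  rw [show 2 * k + 2 = 2 * (k + 1) by ring, pow_mul, Nat.pow_mod, h, one_pow,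
    Nat.one_mod_eq_one.2 (by norm_num)]

/-- Both divisions by `5` are exact, since `p ≡ ±1 (mod 5)`. -/
theorem theorem2p1 (p : ℕ) (hp : p.Prime) (hmod : p % 20 = 11 ∨ p % 20 = 19)
    (n k : ℕ) (hn : ¬ p ∣ n) :
    recipFalseThetaCoeff 9 1
        (8 * p ^ (2 * k + 1) * n + (6 * p ^ (2 * k + 2) + 4) / 5) ≡ 0 [ZMOD 2] ∧
      recipFalseThetaCoeff 9 1
        (8 * p ^ (2 * k + 1) * n + (26 * p ^ (2 * k + 2) + 4) / 5) ≡ 0 [ZMOD 2] := by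
  have : Fact p.Prime := ⟨hp⟩
  have hp4 : p % 4 = 3 := by omega
  -- With this z the two quotients by 5 are 48z + 2 and 208z + 6.
  obtain ⟨z, hz⟩ : ∃ z, p ^ (2 * k + 2) = 40 * z + 1 :=
    ⟨p ^ (2 * k + 2) / 40, by have := pow_mod_forty hmod k; omega⟩
  have hzZ : (p : ℤ) ^ (2 * k + 2) = 40 * z + 1 := by exact_mod_cast hz
  have hcop : Nat.Coprime p 40 := by
    refine (Nat.Prime.coprime_iff_not_dvd hp).2 fun h => ?_
    have h40 := Nat.le_of_dvd (by norm_num) h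
    have : p = 11 ∨ p = 31 ∨ p = 19 ∨ p = 39 := by omega
    rcases this with rfl | rfl | rfl | rfl <;> omega
  have h5 : (5 : ZMod p) ≠ 0 := by
    intro h
    have h : ((5 : ℕ) : ZMod p) = 0 := by exact_mod_cast h
    rw [ZMod.natCast_eq_zero_iff] at h
    have := (Nat.prime_dvd_prime_iff_eq hp (by norm_num)).1 h
    omega
  have hu (c : ℤ) : ¬ (p : ℤ) ∣ 40 * n + c * p := by
    rw [dvd_add_left (Dvd.intro_left c rfl)]
    intro h
    have h : p ∣ 40 * n := by exact_mod_cast h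
    exact hn (hcop.dvd_of_dvd_mul_left h)
  constructor
  · refine (ZMod.intCast_eq_intCast_iff _ _ 2).1 ?_
    rw [show 8 * p ^ (2 * k + 1) * n + (6 * p ^ (2 * k + 2) + 4) / 5
      = 8 * (p ^ (2 * k + 1) * n + 6 * z) + 2 by rw [hz, mul_assoc]; omega, ← coeff_recipSeries,
      coeff_recipSeries_eight_mul_add_two, Int.cast_zero]
    refine coeff_thetaA_mul_psi_eq_zero fun x y h => ?_
    -- For m = p^(2k+1) n + 6z, 40m + 6 = p^(2k+1) (40n + 6p), and p does not divide the cofactor.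
    refine sq_add_mul_sq_ne hp4 (d := 5) (by exact_mod_cast h5)
      (by exact_mod_cast isSquare_five_zmod (by omega) (by omega)) (hu 6) k x y ?_
    push_cast at h
    linear_combination h - 6 * hzZ
  · refine (ZMod.intCast_eq_intCast_iff _ _ 2).1 ?_
    rw [show 8 * p ^ (2 * k + 1) * n + (26 * p ^ (2 * k + 2) + 4) / 5
      = 8 * (p ^ (2 * k + 1) * n + 26 * z) + 6 by rw [hz, mul_assoc]; omega, ← coeff_recipSeries,
      coeff_recipSeries_eight_mul_add_six, Int.cast_zero]
    refine coeff_thetaA_mul_psiFive_eq_zero fun x y h => ?_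
    have h25 : ((25 : ℤ) : ZMod p) = 5 * 5 := by
      push_cast
      norm_num
    refine sq_add_mul_sq_ne hp4 (d := 25) (h25 ▸ mul_ne_zero h5 h5) ⟨5, h25⟩ (hu 26) k x y ?_
    push_cast at h
    linear_combination h - 26 * hzZ
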